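/- For an integer $x$ let $\mathrm{Sg}(x)=1$ if $x\ge 0$ and $\mathrm{Sg}(x)=-1$ if $x<0$, and write $(a;q)_\infty=\prod_{i=1}^{\infty}(1-aq^{i-1})$. For all $a,b\in\mathbb{Z}$ and every integer $k\ge 1$, the coefficient of $q^k$ in the formal power series $$\frac{\mathrm{Sg}(a+b)}{(q;q^2)_{\infty}^2\,(q^2;q^2)_{\infty}\,(q^4;q^4)_{\infty}^2}\sum_{n=a}^{b}(3n+1)q^{3n^2+2n}$$ is non-negative, where the sum is empty (equal to $0$) if $a>b$. -/

import Mathlib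

open PowerSeries
open scoped PowerSeries.WithPiTopology

/-- The sign function with value `1` at `0`: `Sg x = 1` if `x ≥ 0` and `Sg x = -1` if `x < 0`. -/
def Sg (x : ℤ) : ℤ := if 0 ≤ x then 1 else -1

/-- The infinite `q`-Pochhammer symbol `(a; Q)_∞ = ∏_{i ≥ 0} (1 - a Q ^ i)` of formal power series
`a`, `Q` in one variable, as an infinite product for coefficientwise convergence. -/
noncomputable def qPochInf (a Q : ℚ⟦X⟧) : ℚ⟦X⟧ := ∏' i : ℕ, (1 - a * Q ^ i)

/-- The product `(q; q^2)_∞^2 (q^2; q^2)_∞ (q^4; q^4)_∞^2`, where `q` is the variable `X`. -/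
noncomputable def quintupleDenom : ℚ⟦X⟧ :=
  qPochInf X (X ^ 2) ^ 2 * qPochInf (X ^ 2) (X ^ 2) * qPochInf (X ^ 4) (X ^ 4) ^ 2

/-- The truncated sum `∑_{n = a}^{b} (3 n + 1) q ^ (3 n ^ 2 + 2 n)`, which is empty if `a > b`.
The exponent is non-negative for every integer `n`, so that `Int.toNat` does not truncate. -/
noncomputable def truncSum (a b : ℤ) : ℚ⟦X⟧ :=
  ∑ n ∈ Finset.Icc a b, C ((3 * n + 1 : ℤ) : ℚ) * X ^ (3 * n ^ 2 + 2 * n).toNat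

theorem truncSum_exponent_nonneg (n : ℤ) : 0 ≤ 3 * n ^ 2 + 2 * n := by
  rcases le_or_gt 0 n with h | h <;> nlinarith

/-- The product defining `(q ^ k; q ^ m)_∞` converges when `m ≥ 1`. -/
theorem multipliable_qPochInf (k m : ℕ) (hm : 1 ≤ m) :
    Multipliable fun i : ℕ => (1 : ℚ⟦X⟧) - X ^ k * (X ^ m) ^ i := by
  simp_rw [sub_eq_add_neg]
  apply PowerSeries.WithPiTopology.multipliable_one_add_of_tendsto_order_atTop_nhds_top
  simp_rw [order_neg, ← pow_mul, ← pow_add, order_X_pow]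
  refine ENat.tendsto_nhds_top_iff_natCast_lt.mpr fun n ↦ Filter.eventually_atTop.mpr ⟨n + 1, ?_⟩
  intro i hi
  norm_cast
  nlinarith

theorem constantCoeff_qPochInf (k m : ℕ) (hk : 1 ≤ k) (hm : 1 ≤ m) :
    constantCoeff (qPochInf (X ^ k) (X ^ m)) = 1 := by
  unfold qPochInf
  rw [(multipliable_qPochInf k m hm).map_tprod _
    (PowerSeries.WithPiTopology.continuous_constantCoeff ℚ)]
  have h : k ≠ 0 := by omega
  simp [h]

/-- The denominator is an invertible power series, so that division by it is meaningful. -/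
theorem constantCoeff_quintupleDenom : constantCoeff quintupleDenom = 1 := by
  have h1 := constantCoeff_qPochInf 1 2 (by norm_num) (by norm_num)
  have h2 := constantCoeff_qPochInf 2 2 (by norm_num) (by norm_num)
  have h4 := constantCoeff_qPochInf 4 4 (by norm_num) (by norm_num)
  rw [pow_one] at h1
  simp [quintupleDenom, h1, h2, h4]

theorem quintupleDenom_mul_inv : quintupleDenom * quintupleDenom⁻¹ = 1 :=
  PowerSeries.mul_inv_cancel _ (by rw [constantCoeff_quintupleDenom]; exact one_ne_zero)

/-! The argument combines the weighted quintuple product identity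
`∑ (3 n + 1) q ^ (3 n ^ 2 + 2 n) = D`, where `D = (q; q²)²(q²; q²)(q⁴; q⁴)²`
(`hasSum_quintupleDenom`), with an elementary estimate for the tails of the series.

*The identity.* The `q`-binomial theorem gives, in the limit, Gauss's identity
`∑ (-1) ^ i q ^ (i ^ 2) = (q; q²)²(q²; q²)` and, after a differentiation, Jacobi's identity
`∑ (-1) ^ j (2 j + 1) q ^ (2 j ^ 2 + 2 j) = 2 (q⁴; q⁴)³`. In their product the weight `2 j + 1` may
be replaced by `A = 2 j + 1 + i`, because terms odd in `i` cancel. The exponent is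
`(2 A ^ 2 + B ^ 2) / 6 - 1 / 2` with `B = 2 j + 1 - 2 i`, and `A ≡ B` modulo `3`. The terms with
`3 ∣ A` cancel under `A ↦ -A`, and each of the classes `A ≡ 1` and `A ≡ -1` gives the product of
`∑ (3 n + 1) q ^ (3 n ^ 2 + 2 n)` and the pentagonal series for `(q⁴; q⁴)`. Cancelling `(q⁴; q⁴)`
proves the identity.

*The tails.* Order the terms by their exponents `0, 1, 5, 8, 16, 21, …`, so that the indices are
`0, -1, 1, -2, 2, …` and the signs alternate. By the identity, a truncated sum divided by `D` is
`1` minus the corresponding tail divided by `D`. The series `1 / D` is `1 / (1 - q) ^ 2` times a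
series with nonnegative coefficients (`exists_quintupleDenom_inv_eq`), and a proper tail divided by
`(1 - q) ^ 2` already has coefficients of constant sign: its twice iterated partial sums are
piecewise linear between the exponents, with an explicit polynomial value
(`sum_rampPos_nonneg`, `sum_rampNeg_nonneg`). This treats the truncations to `-n ≤ m ≤ n` and
`-n ≤ m ≤ n - 1`. For any other interval, the terms beyond the largest such truncation it contains
all have the sign of `a + b`. -/

/-! ### Gaussian binomial coefficients -/

section GaussBinom

variable {R : Type*} [CommRing R]

/-- The finite `q`-factorial `(Q; Q)_n = ∏_{i = 1}^{n} (1 - Q ^ i)`. -/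
def qPoch (Q : R) (n : ℕ) : R := ∏ i ∈ Finset.range n, (1 - Q ^ (i + 1))

/-- The Gaussian binomial coefficient of `n` and `k` at `Q`, defined by a `q`-Pascal rule; it
vanishes for `k > n`. -/
def gaussBinom (Q : R) : ℕ → ℕ → R
  | _, 0 => 1
  | 0, _ + 1 => 0
  | n + 1, k + 1 => gaussBinom Q n k + Q ^ (k + 1) * gaussBinom Q n (k + 1)

@[simp] theorem gaussBinom_zero_right (Q : R) (n : ℕ) : gaussBinom Q n 0 = 1 := by
  cases n <;> rfl

theorem gaussBinom_succ_succ (Q : R) (n k : ℕ) :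
    gaussBinom Q (n + 1) (k + 1) = gaussBinom Q n k + Q ^ (k + 1) * gaussBinom Q n (k + 1) := rfl

theorem gaussBinom_of_lt (Q : R) {n k : ℕ} (h : n < k) : gaussBinom Q n k = 0 := by
  induction n generalizing k with
  | zero => cases k with
    | zero => omega
    | succ k => rfl
  | succ n ih => cases k with
    | zero => omega
    | succ k => rw [gaussBinom_succ_succ, ih (by omega), ih (by omega)]; simp

theorem qPoch_succ (Q : R) (n : ℕ) : qPoch Q (n + 1) = qPoch Q n * (1 - Q ^ (n + 1)) :=
  Finset.prod_range_succ _ _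

theorem qPoch_mul_qPoch_mul_gaussBinom (Q : R) (a b : ℕ) :
    qPoch Q a * qPoch Q b * gaussBinom Q (a + b) a = qPoch Q (a + b) := by
  induction h : a + b generalizing a b with
  | zero =>
    obtain ⟨rfl, rfl⟩ : a = 0 ∧ b = 0 := by omega
    simp [qPoch]
  | succ n ih =>
    obtain _ | a := a
    · obtain rfl : b = n + 1 := by omega
      simp [qPoch]
    rw [gaussBinom_succ_succ]
    obtain rfl : n = a + b := by omega
    have h1 := ih a b rfl
    obtain _ | b := b
    · rw [gaussBinom_of_lt Q (show a + 0 < a + 1 by omega), qPoch_succ Q a]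
      simp only [add_zero] at h1 ⊢
      linear_combination (1 - Q ^ (a + 1)) * h1
    · have h2 := ih (a + 1) b (by omega)
      rw [qPoch_succ Q (a + (b + 1))]
      have h3 := qPoch_succ Q a
      have h4 := qPoch_succ Q b
      have e : Q ^ (a + (b + 1) + 1) = Q ^ (a + 1) * Q ^ (b + 1) := by ring
      rw [e]
      linear_combination (1 - Q ^ (a + 1)) * h1 + Q ^ (a + 1) * (1 - Q ^ (b + 1)) * h2 +
        qPoch Q (b + 1) * gaussBinom Q (a + (b + 1)) a * h3 +
        Q ^ (a + 1) * gaussBinom Q (a + (b + 1)) (a + 1) * qPoch Q (a + 1) * h4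

/-- The `q`-binomial theorem, in homogeneous form. -/
theorem prod_add_mul_pow (Q x y : R) (n : ℕ) :
    ∏ i ∈ Finset.range n, (y + x * Q ^ i) =
      ∑ k ∈ Finset.range (n + 1), gaussBinom Q n k * Q ^ k.choose 2 * x ^ k * y ^ (n - k) := by
  induction n generalizing x with
  | zero => simp
  | succ n ih =>
    have h : ∏ i ∈ Finset.range n, (y + x * Q ^ (i + 1)) =
        ∏ i ∈ Finset.range n, (y + (x * Q) * Q ^ i) :=
      Finset.prod_congr rfl fun i _ => by ring
    rw [Finset.prod_range_succ', h, ih, Finset.sum_range_succ' _ (n + 1)]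
    have h1 : ∀ k ∈ Finset.range (n + 1),
        gaussBinom Q (n + 1) (k + 1) * Q ^ (k + 1).choose 2 * x ^ (k + 1) *
          y ^ (n + 1 - (k + 1)) =
        x * (gaussBinom Q n k * Q ^ k.choose 2 * (x * Q) ^ k * y ^ (n - k)) +
        gaussBinom Q n (k + 1) * Q ^ (k + 1).choose 2 * (x * Q) ^ (k + 1) *
          y ^ (n - k) := by
      intro k hk
      have e : (k + 1).choose 2 = k + k.choose 2 := by
        rw [Nat.choose_succ_succ' k 1, Nat.choose_one_right]
      rw [gaussBinom_succ_succ, e, Nat.add_sub_add_right]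
      ring
    rw [Finset.sum_congr rfl h1, Finset.sum_add_distrib, ← Finset.mul_sum,
      Finset.sum_range_succ (fun k => gaussBinom Q n (k + 1) * Q ^ (k + 1).choose 2 *
        (x * Q) ^ (k + 1) * y ^ (n - k)) n, gaussBinom_of_lt Q (Nat.lt_succ_self n)]
    have h2 : ∑ k ∈ Finset.range n, gaussBinom Q n (k + 1) * Q ^ (k + 1).choose 2 *
        (x * Q) ^ (k + 1) * y ^ (n - k) =
        y * ∑ k ∈ Finset.range n, gaussBinom Q n (k + 1) * Q ^ (k + 1).choose 2 *
        (x * Q) ^ (k + 1) * y ^ (n - (k + 1)) := by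
      rw [Finset.mul_sum]
      refine Finset.sum_congr rfl fun k hk => ?_
      rw [show n - k = (n - (k + 1)) + 1 by have := Finset.mem_range.mp hk; omega]
      ring
    rw [h2]
    rw [Finset.sum_range_succ' (fun k => gaussBinom Q n k * Q ^ k.choose 2 * (x * Q) ^ k *
      y ^ (n - k)) n]
    simp only [gaussBinom_zero_right, Nat.choose_zero_succ, pow_zero, Nat.sub_zero]
    ring

end GaussBinom

/-! ### Finite forms of Gauss's and Jacobi's identities -/

section Finite

variable {R : Type*} [CommRing R] [IsDomain R]

/-- A finite form of Gauss's identity `∑ (-1) ^ j q ^ (j ^ 2) = (q; q²)²(q²; q²)`, with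
`j = k - N`. -/
theorem sq_prod_one_sub_odd_pow {q : R} (hq : q ≠ 0) (N : ℕ) :
    (∏ i ∈ Finset.range N, (1 - q ^ (2 * i + 1))) ^ 2 =
      ∑ k ∈ Finset.range (2 * N + 1),
        (-1) ^ (N + k) * q ^ (((k : ℤ) - N) ^ 2).toNat * gaussBinom (q ^ 2) (2 * N) k := by
  have key := prod_add_mul_pow (q ^ 2) (-q) (q ^ (2 * N)) (2 * N)
  have hl : ∏ i ∈ Finset.range (2 * N), (q ^ (2 * N) + -q * (q ^ 2) ^ i) =
      (-1) ^ N * q ^ (3 * N ^ 2) * (∏ i ∈ Finset.range N, (1 - q ^ (2 * i + 1))) ^ 2 := by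
    rw [two_mul N, Finset.prod_range_add]
    have e1 : ∏ i ∈ Finset.range N, (q ^ (N + N) + -q * (q ^ 2) ^ i) =
        (-1) ^ N * q ^ (N ^ 2) * ∏ i ∈ Finset.range N, (1 - q ^ (2 * i + 1)) := by
      rw [← Finset.prod_range_reflect (fun i => 1 - q ^ (2 * i + 1))]
      have e0 : (-1) ^ N * q ^ (N ^ 2) = ∏ i ∈ Finset.range N, (-q ^ (2 * i + 1)) := by
        rw [Finset.prod_neg, Finset.prod_pow_eq_pow_sum, Finset.sum_add_distrib,
          ← Finset.mul_sum, Finset.card_range]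
        have := Finset.sum_range_id_mul_two N
        congr 2
        simp only [Finset.sum_const, Finset.card_range, smul_eq_mul, mul_one]
        rw [mul_comm 2, this]
        cases N
        · rfl
        · simp; ring
      rw [e0, ← Finset.prod_mul_distrib]
      refine Finset.prod_congr rfl fun i hi => ?_
      have hi := Finset.mem_range.mp hi
      have e3 : q ^ (N + N) = q ^ (2 * i + 1) * q ^ (2 * (N - 1 - i) + 1) := by
        rw [← pow_add]; congr 1; omega
      rw [e3]
      ring
    have e2 : ∏ i ∈ Finset.range N, (q ^ (N + N) + -q * (q ^ 2) ^ (N + i)) =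
        q ^ (2 * N ^ 2) * ∏ i ∈ Finset.range N, (1 - q ^ (2 * i + 1)) := by
      have e0 : q ^ (2 * N ^ 2) = ∏ i ∈ Finset.range N, q ^ (2 * N) := by
        rw [Finset.prod_const, Finset.card_range, ← pow_mul]; ring
      rw [e0, ← Finset.prod_mul_distrib]
      exact Finset.prod_congr rfl fun i _ => by ring
    rw [e1, e2]; ring
  rw [hl] at key
  have hc : (-1) ^ N * q ^ (3 * N ^ 2) ≠ 0 := by simp [hq]
  apply mul_left_cancel₀ hc
  rw [key, Finset.mul_sum]
  refine Finset.sum_congr rfl fun k hk => ?_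
  have hk := Finset.mem_range.mp hk
  have ex : 2 * k.choose 2 + k + 2 * N * (2 * N - k) =
      3 * N ^ 2 + (((k : ℤ) - N) ^ 2).toNat := by
    have h1 : 2 * k.choose 2 + k = k ^ 2 := by
      rw [Nat.choose_two_right, Nat.mul_div_cancel' (Nat.even_mul_pred_self k).two_dvd]
      cases k
      · rfl
      · simp; ring
    rw [h1]
    zify [show k ≤ 2 * N by omega]
    rw [Int.toNat_of_nonneg (sq_nonneg _)]
    ring
  have sg : ((-1 : R)) ^ N * (-1) ^ (N + k) = (-1) ^ k := by
    rw [← pow_add, ← add_assoc, pow_add, ← two_mul, pow_mul]; simp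
  calc _ = gaussBinom (q ^ 2) (2 * N) k * (-1) ^ k *
        q ^ (2 * k.choose 2 + k + 2 * N * (2 * N - k)) := by
          rw [neg_pow q k]; ring
    _ = _ := by rw [ex, ← sg]; ring

/-- A finite form of Jacobi's identity `∑ (-1) ^ i (2 i + 1) Q ^ (i (i + 1) / 2) = 2 (Q; Q)³`, the
sum being over all integers `i`; here `i = k - N - 1` and `Q = q ^ 4`. -/
theorem two_mul_sq_qPoch {q : R} (hq : q ≠ 0) (N : ℕ) :
    2 * qPoch (q ^ 4) N ^ 2 =
      ∑ k ∈ Finset.range (2 * N + 2), (-1) ^ (N + 1 + k) * (2 * ((k : R) - N - 1) + 1) *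
        q ^ (2 * ((k : ℤ) - N - 1) ^ 2 + 2 * ((k : ℤ) - N - 1)).toNat *
        gaussBinom (q ^ 4) (2 * N + 1) k := by
  obtain ⟨Q, hQ⟩ : ∃ Q : R, Q = q ^ 4 := ⟨_, rfl⟩
  rw [← hQ]
  have hQ0 : Q ≠ 0 := hQ ▸ pow_ne_zero _ hq
  -- The `q`-binomial theorem for `∏ (Q ^ N - w Q ^ i)`, whose factor `i = N` is `Q ^ N (1 - w)`.
  have key := prod_add_mul_pow (Polynomial.C Q) (-Polynomial.X : Polynomial R)
    (Polynomial.C Q ^ N) (2 * N + 1)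
  set A : Polynomial R := ∏ i ∈ Finset.range N, (Polynomial.C Q ^ N +
    -Polynomial.X * Polynomial.C Q ^ i) with hA
  set B : Polynomial R := ∏ i ∈ Finset.range N, (Polynomial.C Q ^ N +
    -Polynomial.X * Polynomial.C Q ^ (N + 1 + i)) with hB
  have hl : ∏ i ∈ Finset.range (2 * N + 1), (Polynomial.C Q ^ N +
      -Polynomial.X * Polynomial.C Q ^ i) =
      A * (Polynomial.C (Q ^ N) * (1 - Polynomial.X)) * B := by
    rw [show 2 * N + 1 = N + 1 + N by ring, Finset.prod_range_add, Finset.prod_range_succ,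
      ← hA, ← hB, Polynomial.C_pow]
    ring
  rw [hl] at key
  have gC : ∀ n k, gaussBinom (Polynomial.C Q) n k = Polynomial.C (gaussBinom Q n k) := by
    intro n
    induction n with
    | zero => intro k; cases k <;> simp [gaussBinom]
    | succ n ih => intro k; cases k <;> simp [gaussBinom, ih]
  have eA : A.eval 1 = (-1) ^ N * Q ^ N.choose 2 * qPoch Q N := by
    have e0 : (-1) ^ N * Q ^ N.choose 2 = ∏ i ∈ Finset.range N, (-Q ^ i) := by
      rw [Finset.prod_neg, Finset.prod_pow_eq_pow_sum, Finset.sum_range_id,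
        Nat.choose_two_right, Finset.card_range]
    rw [hA, Polynomial.eval_prod, e0, qPoch,
      ← Finset.prod_range_reflect (fun i => 1 - Q ^ (i + 1)), ← Finset.prod_mul_distrib]
    refine Finset.prod_congr rfl fun i hi => ?_
    have hi := Finset.mem_range.mp hi
    have e3 : Q ^ N = Q ^ i * Q ^ (N - 1 - i + 1) := by
      rw [← pow_add]; congr 1; omega
    simp [e3]
    ring
  have eB : B.eval 1 = Q ^ (N ^ 2) * qPoch Q N := by
    have e0 : Q ^ (N ^ 2) = ∏ i ∈ Finset.range N, Q ^ N := by
      rw [Finset.prod_const, Finset.card_range, ← pow_mul, sq]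
    rw [hB, Polynomial.eval_prod, e0, qPoch, ← Finset.prod_mul_distrib]
    refine Finset.prod_congr rfl fun i hi => ?_
    simp
    ring
  have k0 := congrArg (Polynomial.eval 1) key
  have k1 := congrArg (fun p => Polynomial.eval 1 (Polynomial.derivative p)) key
  have tm : ∀ k, gaussBinom (Polynomial.C Q) (2 * N + 1) k * Polynomial.C Q ^ k.choose 2 *
      (-Polynomial.X) ^ k * (Polynomial.C Q ^ N) ^ (2 * N + 1 - k) =
      Polynomial.C (gaussBinom Q (2 * N + 1) k * Q ^ k.choose 2 * (-1) ^ k *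
        Q ^ (N * (2 * N + 1 - k))) * Polynomial.X ^ k := by
    intro k
    rw [gC, neg_pow (Polynomial.X : Polynomial R) k]
    simp only [Polynomial.C_mul, Polynomial.C_pow, Polynomial.C_neg, Polynomial.C_1]
    ring
  simp only [tm, Polynomial.eval_finsetSum, Polynomial.derivative_sum,
    Polynomial.derivative_C_mul_X_pow] at k0 k1
  simp only [Polynomial.derivative_mul, Polynomial.eval_mul, Polynomial.eval_add,
    Polynomial.derivative_C, Polynomial.derivative_sub, Polynomial.derivative_one,
    Polynomial.derivative_X, Polynomial.eval_sub, Polynomial.eval_one, Polynomial.eval_X,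
    Polynomial.eval_C, Polynomial.eval_pow, one_pow, mul_one, Polynomial.eval_neg, eA, eB,
    sub_self, mul_zero, zero_mul, zero_add, add_zero, zero_sub] at k0 k1
  have hc : (-1) ^ N * Q ^ (N + N.choose 2 + N ^ 2) ≠ 0 := by simp [hQ0]
  apply mul_left_cancel₀ hc
  have hk : (-1) ^ N * Q ^ (N + N.choose 2 + N ^ 2) * (2 * qPoch Q N ^ 2) =
      -2 * ((-1) ^ N * Q ^ N.choose 2 * qPoch Q N * (Q ^ N * -1) *
        (Q ^ N ^ 2 * qPoch Q N)) + (2 * N + 1) * 0 := by ring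
  rw [hk]
  conv_lhs => rw [k1]
  rw [k0, Finset.mul_sum, Finset.mul_sum, Finset.mul_sum, ← Finset.sum_add_distrib]
  refine Finset.sum_congr rfl fun k hk => ?_
  have hk := Finset.mem_range.mp hk
  have ex : 4 * (k.choose 2 + N * (2 * N + 1 - k)) = 4 * (N + N.choose 2 + N ^ 2) +
      (2 * ((k : ℤ) - N - 1) ^ 2 + 2 * ((k : ℤ) - N - 1)).toNat := by
    have h1 : ∀ k : ℕ, (2 * k.choose 2 : ℤ) = k ^ 2 - k := by
      intro k
      have : 2 * k.choose 2 = k * (k - 1) := by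
        rw [Nat.choose_two_right, Nat.mul_div_cancel' (Nat.even_mul_pred_self k).two_dvd]
      cases k
      · rfl
      · simp at this; zify at this; push_cast; linarith
    have h2 : 0 ≤ 2 * ((k : ℤ) - N - 1) ^ 2 + 2 * ((k : ℤ) - N - 1) := by
      rcases le_or_gt 0 ((k : ℤ) - N - 1) with h | h <;> nlinarith
    zify [show k ≤ 2 * N + 1 by omega]
    rw [Int.toNat_of_nonneg h2]
    linear_combination 2 * h1 k - 2 * h1 N
  have exq : Q ^ (k.choose 2) * Q ^ (N * (2 * N + 1 - k)) = Q ^ (N + N.choose 2 + N ^ 2) *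
      q ^ (2 * ((k : ℤ) - N - 1) ^ 2 + 2 * ((k : ℤ) - N - 1)).toNat := by
    rw [← pow_add, hQ, ← pow_mul, ex, pow_add, pow_mul]
  have sg : ((-1 : R)) ^ N * (-1) ^ (N + 1 + k) = - (-1) ^ k := by
    have : ((-1 : R)) ^ (N + N) = 1 := by rw [← two_mul, pow_mul]; simp
    rw [← pow_add, show N + (N + 1 + k) = (N + N) + 1 + k by ring, pow_add, pow_add, this]; simp
  linear_combination (-2 * k + (2 * N + 1)) * (-1) ^ k * gaussBinom Q (2 * N + 1) k * exq -
    Q ^ (N + N.choose 2 + N ^ 2) * (2 * ((k : R) - N - 1) + 1) *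
      q ^ (2 * ((k : ℤ) - N - 1) ^ 2 + 2 * ((k : ℤ) - N - 1)).toNat *
      gaussBinom Q (2 * N + 1) k * sg

end Finite

/-! ### Congruences and infinite sums of power series -/

/-- The monomial `c q ^ e` with an integer exponent, which is meaningful for `0 ≤ e`. -/
noncomputable def qTerm (c : ℚ) (e : ℤ) : ℚ⟦X⟧ := C c * X ^ e.toNat

theorem coeff_qTerm (c : ℚ) {e : ℤ} (he : 0 ≤ e) (d : ℕ) :
    coeff d (qTerm c e) = if (d : ℤ) = e then c else 0 := by
  rw [qTerm, coeff_C_mul_X_pow]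
  exact if_congr (by omega) rfl rfl

theorem qTerm_mul_qTerm (c c' : ℚ) {e e' : ℤ} (he : 0 ≤ e) (he' : 0 ≤ e') :
    qTerm c e * qTerm c' e' = qTerm (c * c') (e + e') := by
  rw [qTerm, qTerm, qTerm, Int.toNat_add he he', pow_add, map_mul]; ring

theorem qTerm_add (c c' : ℚ) (e : ℤ) : qTerm c e + qTerm c' e = qTerm (c + c') e := by
  simp only [qTerm, map_add, add_mul]

theorem neg_qTerm (c : ℚ) (e : ℤ) : -qTerm c e = qTerm (-c) e := by
  simp only [qTerm, map_neg, neg_mul]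

theorem neg_one_zpow_eq_of_even_sub {m n : ℤ} (h : Even (m - n)) : (-1 : ℚ) ^ m = (-1) ^ n := by
  rw [← sub_add_cancel m n, zpow_add₀ (by norm_num), h.neg_one_zpow, one_mul]

theorem summable_qTerm {ι : Type*} (c : ι → ℚ) (e : ι → ℤ) (he : ∀ i, 0 ≤ e i)
    (hfin : ∀ d : ℕ, {i | e i = d}.Finite) : Summable fun i => qTerm (c i) (e i) := by
  rw [WithPiTopology.summable_iff_summable_coeff]
  intro d
  refine summable_of_hasFiniteSupport ((hfin d).subset fun i hi => ?_)
  rw [Function.mem_support, coeff_qTerm _ (he i)] at hi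
  by_contra h
  exact hi (if_neg fun h' => h h'.symm)

theorem summable_qTerm_int (c : ℤ → ℚ) (e : ℤ → ℤ) (he : ∀ j, 0 ≤ e j)
    (hj : ∀ j, |j| ≤ e j + 1) : Summable fun j => qTerm (c j) (e j) := by
  refine summable_qTerm c e he fun d => (Set.finite_Icc (-(d + 1 : ℤ)) (d + 1)).subset ?_
  intro j (hd : e j = d)
  exact abs_le.mp (hd ▸ hj j)

theorem HasSum.mul_qTerm_int {c c' : ℤ → ℚ} {e e' : ℤ → ℤ} {F F' : ℚ⟦X⟧}
    (he : ∀ j, 0 ≤ e j) (hj : ∀ j, |j| ≤ e j + 1) (he' : ∀ j, 0 ≤ e' j)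
    (hj' : ∀ j, |j| ≤ e' j + 1) (h : HasSum (fun j => qTerm (c j) (e j)) F)
    (h' : HasSum (fun j => qTerm (c' j) (e' j)) F') :
    HasSum (fun p : ℤ × ℤ => qTerm (c p.1 * c' p.2) (e p.1 + e' p.2)) (F * F') := by
  have key : (fun p : ℤ × ℤ => qTerm (c p.1 * c' p.2) (e p.1 + e' p.2)) =
      fun p => qTerm (c p.1) (e p.1) * qTerm (c' p.2) (e' p.2) :=
    funext fun p => (qTerm_mul_qTerm _ _ (he _) (he' _)).symm
  have hs : Summable fun p : ℤ × ℤ => qTerm (c p.1 * c' p.2) (e p.1 + e' p.2) := by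
    refine summable_qTerm _ _ (fun p => add_nonneg (he _) (he' _)) fun d => ?_
    refine ((Set.finite_Icc (-(d + 1 : ℤ)) (d + 1)).prod
      (Set.finite_Icc (-(d + 1 : ℤ)) (d + 1))).subset ?_
    rintro ⟨i, j⟩ (hd : e i + e' j = d)
    have h1 := he i
    have h2 := he' j
    exact ⟨abs_le.mp ((hj i).trans (by linarith)), abs_le.mp ((hj' j).trans (by linarith))⟩
  rw [key] at hs ⊢
  exact HasSum.mul (f := fun j => qTerm (c j) (e j)) (g := fun j => qTerm (c' j) (e' j)) h h' hs

theorem hasSum_zero_of_odd_qTerm {c : ℤ → ℚ} {e : ℤ → ℤ} (he : ∀ j, 0 ≤ e j)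
    (hj : ∀ j, |j| ≤ e j + 1) (hc : ∀ j, c (-j) = -c j) (hev : ∀ j, e (-j) = e j) :
    HasSum (fun j => qTerm (c j) (e j)) 0 := by
  obtain ⟨s, hs⟩ := summable_qTerm_int c e he hj
  have h1 : HasSum (fun j => qTerm (c j) (e j)) (-s) := by
    have h2 := ((Equiv.neg ℤ).hasSum_iff.mpr hs).neg
    refine h2.congr_fun fun j => ?_
    simp [hc, hev, neg_qTerm]
  have h3 : s = -s := hs.unique h1
  have h4 : s = 0 := by
    ext d
    have := congrArg (coeff d) h3
    rw [map_neg] at this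
    rw [map_zero]
    linarith
  exact h4 ▸ hs

/-- A criterion for the value of the sum of a series over `ℤ`, in terms of congruences for partial
sums along windows `{-o N, …, w N - o N - 1}` containing `{-N, …, N}`. -/
theorem hasSum_qTerm_of_dvd {c : ℤ → ℚ} {e : ℤ → ℤ} {F : ℚ⟦X⟧} (o w : ℕ → ℕ)
    (he : ∀ j, 0 ≤ e j) (hj : ∀ j, |j| ≤ e j + 1) (ho : ∀ N, N ≤ o N)
    (hw : ∀ N, o N + N < w N)
    (h : ∀ N, X ^ N ∣ F - ∑ k ∈ Finset.range (w N), qTerm (c (k - o N)) (e (k - o N))) :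
    HasSum (fun j => qTerm (c j) (e j)) F := by
  rw [WithPiTopology.hasSum_iff_hasSum_coeff]
  intro d
  have hd := (X_pow_dvd_iff.mp (h (d + 1))) d (by omega)
  rw [map_sub, sub_eq_zero, map_sum] at hd
  let f : ℕ ↪ ℤ := ⟨fun k => (k : ℤ) - o (d + 1), fun a b hab => by simpa using hab⟩
  have hs := Finset.sum_map (Finset.range (w (d + 1))) f fun j => coeff d (qTerm (c j) (e j))
  rw [hd, show ∑ k ∈ Finset.range (w (d + 1)), coeff d (qTerm (c (k - o (d + 1)))
    (e (k - o (d + 1)))) = _ from hs.symm]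
  refine hasSum_sum_of_ne_finset_zero fun j hjs => ?_
  rw [coeff_qTerm _ (he j)]
  refine if_neg fun hde => hjs ?_
  have h1 := abs_le.mp (hde ▸ hj j)
  have h2 := ho (d + 1)
  have h3 := hw (d + 1)
  refine Finset.mem_map.mpr ⟨(j + o (d + 1)).toNat, Finset.mem_range.mpr ?_, ?_⟩
  · omega
  · change (((j + o (d + 1)).toNat : ℕ) : ℤ) - o (d + 1) = j
    omega

/-! ### Infinite `q`-Pochhammer symbols -/

theorem X_pow_dvd_qPochInf_sub {k m : ℕ} (hm : 1 ≤ m) (N : ℕ) :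
    (X : ℚ⟦X⟧) ^ (k + m * N) ∣
      qPochInf (X ^ k) (X ^ m) - ∏ i ∈ Finset.range N, (1 - X ^ k * (X ^ m) ^ i) := by
  rw [X_pow_dvd_iff]
  intro d hd
  rw [map_sub, sub_eq_zero]
  have ht := (multipliable_qPochInf k m hm).hasProd.tendsto_prod_nat
  rw [WithPiTopology.tendsto_iff_coeff_tendsto] at ht
  refine tendsto_nhds_unique (ht d) (tendsto_atTop_of_eventually_const (i₀ := N) fun n hn => ?_)
  induction n, hn using Nat.le_induction with
  | base => rfl
  | succ n hn ih =>
    rw [Finset.prod_range_succ, mul_sub, mul_one, map_sub, ih, sub_eq_self, ← pow_mul, ← pow_add]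
    refine X_pow_dvd_iff.mp (Dvd.intro_left _ rfl) d (hd.trans_le ?_)
    gcongr

theorem isUnit_qPochInf {k m : ℕ} (hk : 1 ≤ k) (hm : 1 ≤ m) :
    IsUnit (qPochInf (X ^ k) (X ^ m)) := by
  rw [isUnit_iff_constantCoeff, constantCoeff_qPochInf k m hk hm]
  exact isUnit_one

theorem X_pow_dvd_qPochInf_sub_qPoch {r : ℕ} (hr : 1 ≤ r) {m a : ℕ} (h : m ≤ a) :
    (X : ℚ⟦X⟧) ^ (r * (m + 1)) ∣ qPochInf (X ^ r) (X ^ r) - qPoch (X ^ r) a := by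
  have h1 := X_pow_dvd_qPochInf_sub (k := r) hr a
  have h2 : ∏ i ∈ Finset.range a, (1 - (X : ℚ⟦X⟧) ^ r * (X ^ r) ^ i) = qPoch (X ^ r) a :=
    Finset.prod_congr rfl fun i _ => by rw [pow_succ']
  rw [h2] at h1
  refine (pow_dvd_pow _ ?_).trans h1
  nlinarith

/-- As `a` and `b` grow, the Gaussian binomial coefficient of `a + b` and `a` tends to the inverse
of the infinite product `(Q; Q)_∞`. -/
theorem X_pow_dvd_qPochInf_mul_gaussBinom_sub_one {r : ℕ} (hr : 1 ≤ r) {m a b : ℕ} (ha : m ≤ a)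
    (hb : m ≤ b) : (X : ℚ⟦X⟧) ^ (r * (m + 1)) ∣
      qPochInf (X ^ r) (X ^ r) * gaussBinom (X ^ r) (a + b) a - 1 := by
  rw [← (isUnit_qPochInf hr hr).dvd_mul_left]
  have e : qPochInf (X ^ r) (X ^ r) *
      (qPochInf (X ^ r) (X ^ r) * gaussBinom (X ^ r) (a + b) a - 1) =
      (qPochInf (X ^ r) (X ^ r) - qPoch (X ^ r) a) *
        (qPochInf (X ^ r) (X ^ r) * gaussBinom (X ^ r) (a + b) a) +
      (qPochInf (X ^ r) (X ^ r) - qPoch (X ^ r) b) *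
        (qPoch (X ^ r) a * gaussBinom (X ^ r) (a + b) a) -
      (qPochInf (X ^ r) (X ^ r) - qPoch (X ^ r) (a + b)) := by
    linear_combination qPoch_mul_qPoch_mul_gaussBinom ((X : ℚ⟦X⟧) ^ r) a b
  rw [e]
  refine dvd_sub (dvd_add ?_ ?_) (X_pow_dvd_qPochInf_sub_qPoch hr (by omega))
  · exact (X_pow_dvd_qPochInf_sub_qPoch hr ha).mul_right _
  · exact (X_pow_dvd_qPochInf_sub_qPoch hr hb).mul_right _

/-! ### Theta series as infinite products -/

/-- Gauss's identity `∑ (-1) ^ j q ^ (j ^ 2) = (q; q²)²(q²; q²)`. -/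
theorem hasSum_gauss : HasSum (fun j : ℤ => qTerm ((-1) ^ j) (j ^ 2))
    (qPochInf X (X ^ 2) ^ 2 * qPochInf (X ^ 2) (X ^ 2)) := by
  refine hasSum_qTerm_of_dvd (fun N => N) (fun N => 2 * N + 1) (fun j => sq_nonneg j)
    (fun j => by rw [← sq_abs]; nlinarith [sq_nonneg (|j| - 1)]) (fun N => le_rfl)
    (fun N => by omega) fun N => ?_
  set E := qPochInf (X ^ 2) (X ^ 2)
  have h1 := X_pow_dvd_qPochInf_sub (k := 1) (m := 2) (by norm_num) N
  have h2 : ∏ i ∈ Finset.range N, (1 - (X : ℚ⟦X⟧) ^ 1 * (X ^ 2) ^ i) =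
      ∏ i ∈ Finset.range N, (1 - X ^ (2 * i + 1)) :=
    Finset.prod_congr rfl fun i _ => by rw [← pow_mul, ← pow_add, add_comm 1]
  rw [h2, pow_one] at h1
  set O := qPochInf (X : ℚ⟦X⟧) (X ^ 2)
  set P := ∏ i ∈ Finset.range N, (1 - (X : ℚ⟦X⟧) ^ (2 * i + 1)) with hP
  have h3 : O ^ 2 * E - ∑ k ∈ Finset.range (2 * N + 1),
      qTerm ((-1) ^ ((k : ℤ) - N)) (((k : ℤ) - N) ^ 2) =
      (O - P) * ((O + P) * E) + ∑ k ∈ Finset.range (2 * N + 1),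
        qTerm ((-1) ^ ((k : ℤ) - N)) (((k : ℤ) - N) ^ 2) *
          (E * gaussBinom (X ^ 2) (2 * N) k - 1) := by
    have h4 : P ^ 2 * E = ∑ k ∈ Finset.range (2 * N + 1),
        qTerm ((-1) ^ ((k : ℤ) - N)) (((k : ℤ) - N) ^ 2) *
          (E * gaussBinom (X ^ 2) (2 * N) k) := by
      rw [hP, sq_prod_one_sub_odd_pow X_ne_zero N, Finset.sum_mul]
      refine Finset.sum_congr rfl fun k _ => ?_
      have : (-1 : ℚ) ^ ((k : ℤ) - N) = (-1) ^ (N + k) := by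
        rw [← zpow_natCast]
        exact neg_one_zpow_eq_of_even_sub ⟨-N, by push_cast; ring⟩
      rw [qTerm, this]
      simp only [map_pow, map_neg, map_one]
      ring
    simp only [mul_sub, mul_one, Finset.sum_sub_distrib]
    rw [← h4]
    ring
  rw [h3]
  refine dvd_add (((pow_dvd_pow _ (by omega)).trans h1).mul_right _) (Finset.dvd_sum fun k hk => ?_)
  have hk := Finset.mem_range.mp hk
  have hb := X_pow_dvd_qPochInf_mul_gaussBinom_sub_one (r := 2) (by norm_num)
    (min_le_left k (2 * N - k)) (min_le_right k (2 * N - k))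
  rw [show k + (2 * N - k) = 2 * N by omega] at hb
  have hq : (X : ℚ⟦X⟧) ^ (((k : ℤ) - N) ^ 2).toNat ∣
      qTerm ((-1) ^ ((k : ℤ) - N)) (((k : ℤ) - N) ^ 2) := Dvd.intro_left _ rfl
  refine (pow_dvd_pow _ ?_).trans ((pow_add (X : ℚ⟦X⟧) _ _).dvd.trans (mul_dvd_mul hq hb))
  zify
  rw [Int.toNat_of_nonneg (sq_nonneg _)]
  push_cast [show k ≤ 2 * N by omega]
  rcases le_total k N with h | h
  · rw [min_eq_left (by omega)]; nlinarith [sq_nonneg ((k : ℤ) - N + 1)]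
  · rw [min_eq_right (by omega)]; nlinarith [sq_nonneg ((k : ℤ) - N - 1)]

theorem two_mul_sq_add_two_mul_nonneg (j : ℤ) : 0 ≤ 2 * j ^ 2 + 2 * j := by
  rcases le_or_gt 0 j with h | h <;> nlinarith

theorem abs_le_two_mul_sq_add_two_mul (j : ℤ) : |j| ≤ 2 * j ^ 2 + 2 * j + 1 := by
  rw [abs_le]
  constructor <;> rcases le_or_gt 0 j with h | h <;> nlinarith

/-- Jacobi's identity `∑ (-1) ^ j (2 j + 1) q ^ (2 j ^ 2 + 2 j) = 2 (q⁴; q⁴)³`, summed over all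
integers `j`. -/
theorem hasSum_jacobi : HasSum
    (fun j : ℤ => qTerm ((-1) ^ j * (2 * j + 1)) (2 * j ^ 2 + 2 * j))
    (2 * qPochInf (X ^ 4) (X ^ 4) ^ 3) := by
  refine hasSum_qTerm_of_dvd (fun N => N + 1) (fun N => 2 * N + 2) two_mul_sq_add_two_mul_nonneg
    abs_le_two_mul_sq_add_two_mul (fun N => by omega) (fun N => by omega) fun N => ?_
  set E := qPochInf (X ^ 4) (X ^ 4)
  have h1 := X_pow_dvd_qPochInf_sub_qPoch (r := 4) (by norm_num) (le_refl N)
  set P := qPoch ((X : ℚ⟦X⟧) ^ 4) N with hP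
  set t : ℕ → ℚ⟦X⟧ := fun k => qTerm
    ((-1) ^ ((k : ℤ) - (N + 1 : ℕ)) * (2 * ((k - (N + 1 : ℕ) : ℤ) : ℚ) + 1))
    (2 * ((k : ℤ) - (N + 1 : ℕ)) ^ 2 + 2 * ((k : ℤ) - (N + 1 : ℕ))) with ht
  have h3 : 2 * E ^ 3 - ∑ k ∈ Finset.range (2 * N + 2), t k =
      (E - P) * (2 * (E + P) * E) + ∑ k ∈ Finset.range (2 * N + 2), t k *
          (E * gaussBinom (X ^ 4) (2 * N + 1) k - 1) := by
    have h4 : 2 * P ^ 2 * E = ∑ k ∈ Finset.range (2 * N + 2), t k *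
          (E * gaussBinom (X ^ 4) (2 * N + 1) k) := by
      rw [hP, two_mul_sq_qPoch X_ne_zero N, Finset.sum_mul]
      refine Finset.sum_congr rfl fun k _ => ?_
      have : (-1 : ℚ) ^ ((k : ℤ) - (N + 1 : ℕ)) = (-1) ^ (N + 1 + k) := by
        rw [← zpow_natCast]
        exact neg_one_zpow_eq_of_even_sub ⟨-(N + 1), by push_cast; ring⟩
      have hs : (k : ℤ) - (N + 1 : ℕ) = (k : ℤ) - N - 1 := by push_cast; ring
      rw [ht]
      simp only [qTerm]
      rw [this, hs]
      push_cast
      simp only [map_pow, map_neg, map_one, map_mul, map_add, map_sub, map_natCast, map_ofNat]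
      ring
    simp only [mul_sub, mul_one, Finset.sum_sub_distrib]
    rw [← h4]
    ring
  rw [h3]
  refine dvd_add (((pow_dvd_pow _ (by omega)).trans h1).mul_right _) (Finset.dvd_sum fun k hk => ?_)
  have hk := Finset.mem_range.mp hk
  have hb := X_pow_dvd_qPochInf_mul_gaussBinom_sub_one (r := 4) (by norm_num)
    (min_le_left k (2 * N + 1 - k)) (min_le_right k (2 * N + 1 - k))
  rw [show k + (2 * N + 1 - k) = 2 * N + 1 by omega] at hb
  have hq : (X : ℚ⟦X⟧) ^ (2 * ((k : ℤ) - (N + 1 : ℕ)) ^ 2 + 2 * ((k : ℤ) - (N + 1 : ℕ))).toNat ∣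
      t k := Dvd.intro_left _ rfl
  refine (pow_dvd_pow _ ?_).trans ((pow_add (X : ℚ⟦X⟧) _ _).dvd.trans (mul_dvd_mul hq hb))
  zify
  rw [Int.toNat_of_nonneg (two_mul_sq_add_two_mul_nonneg _)]
  push_cast [show k ≤ 2 * N + 1 by omega]
  rcases le_or_gt k N with h | h
  · rw [min_eq_left (by omega)]; nlinarith [sq_nonneg ((k : ℤ) - N)]
  · rw [min_eq_right (by omega)]; nlinarith [sq_nonneg ((k : ℤ) - N - 1)]

/-- Euler's pentagonal number theorem at `q⁴`: `∑ (-1) ^ l q ^ (6 l ^ 2 + 2 l) = (q⁴; q⁴)`. -/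
theorem hasSum_pentagonal : HasSum (fun l : ℤ => qTerm ((-1) ^ l) (6 * l ^ 2 + 2 * l))
    (qPochInf (X ^ 4) (X ^ 4)) := by
  set φ := expand (R := ℚ) 4 (by norm_num)
  have hφ : Continuous φ := by
    rw [continuous_iff_continuousAt]
    intro f
    refine (WithPiTopology.tendsto_iff_coeff_tendsto _ _ _ _).mpr fun d => ?_
    simp only [φ, coeff_expand]
    split_ifs
    · exact (WithPiTopology.continuous_coeff ℚ (d / 4)).continuousAt
    · exact tendsto_const_nhds
  have h1 : φ (pentagonalSeries ℚ) = qPochInf (X ^ 4) (X ^ 4) := by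
    have := ((WithPiTopology.hasProd_one_sub_X_pow ℚ).map φ hφ).tprod_eq
    rw [← this, qPochInf]
    refine tprod_congr fun i => ?_
    simp [φ, pow_succ']
  rw [← h1, ← (Equiv.neg ℤ).hasSum_iff]
  refine ((WithPiTopology.hasSum_pentagonalSeries ℚ).map φ hφ).congr_fun fun l => ?_
  have h2 : (6 * (-l) ^ 2 + 2 * -l).toNat = 4 * pentagonal l := by
    zify
    rw [Int.toNat_of_nonneg (by rcases le_or_gt l 0 with h | h <;> nlinarith)]
    linear_combination -2 * two_mul_natCast_pentagonal l
  simp only [Function.comp_apply, Equiv.neg_apply, qTerm, h2, map_mul, map_pow, φ, expand_X,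
    pow_mul]
  congr 1
  rw [neg_one_zpow_eq_of_even_sub (n := l) ⟨-l, by ring⟩]
  rcases Int.even_or_odd l with hl | hl
  · simp [hl.neg_one_zpow, Int.negOnePow_even l hl]
  · simp [hl.neg_one_zpow, Int.negOnePow_odd l hl]

/-! ### The weighted quintuple product identity -/

/-- The three parametrizations by `(n, l)` of the pairs `(i, j)` for which `A = 2 j + 1 + i` equals
`3 n + 1`, `-(3 n + 1)` and `3 n`, respectively. -/
def residueParam : (ℤ × ℤ) ⊕ ((ℤ × ℤ) ⊕ (ℤ × ℤ)) → ℤ × ℤ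
  | .inl (n, l) => (n - 2 * l, n + l)
  | .inr (.inl (n, l)) => (-n + 2 * l, -n - l - 1)
  | .inr (.inr (n, l)) => (n - 2 * l - 1, n + l)

theorem bijective_residueParam : Function.Bijective residueParam := by
  constructor
  · rintro (⟨n, l⟩ | ⟨n, l⟩ | ⟨n, l⟩) (⟨n', l'⟩ | ⟨n', l'⟩ | ⟨n', l'⟩) h <;>
      simp only [residueParam, Prod.mk.injEq] at h <;>
      simp only [Sum.inl.injEq, Sum.inr.injEq, Prod.mk.injEq, reduceCtorEq] <;> omega
  · rintro ⟨i, j⟩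
    have h : (2 * j + i) % 3 = 0 ∨ (2 * j + i) % 3 = 1 ∨ (2 * j + i) % 3 = 2 := by omega
    rcases h with h | h | h
    · refine ⟨.inl ((2 * j + i) / 3, j - (2 * j + i) / 3), ?_⟩
      simp only [residueParam, Prod.mk.injEq]; omega
    · refine ⟨.inr (.inl (-((2 * j + i + 2) / 3), -j - 1 + (2 * j + i + 2) / 3)), ?_⟩
      simp only [residueParam, Prod.mk.injEq]; omega
    · refine ⟨.inr (.inr ((2 * j + 1 + i) / 3, j - (2 * j + 1 + i) / 3)), ?_⟩
      simp only [residueParam, Prod.mk.injEq]; omega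

theorem abs_le_three_mul_sq_add_two_mul (n : ℤ) : |n| ≤ 3 * n ^ 2 + 2 * n + 1 := by
  rw [abs_le]
  constructor <;> rcases le_or_gt 0 n with h | h <;> nlinarith

theorem abs_le_sq_add_one (j : ℤ) : |j| ≤ j ^ 2 + 1 := by
  rw [← sq_abs]; nlinarith [sq_nonneg (|j| - 1)]

theorem three_mul_sq_nonneg (j : ℤ) : 0 ≤ 3 * j ^ 2 := by positivity

theorem abs_le_three_mul_sq (j : ℤ) : |j| ≤ 3 * j ^ 2 + 1 :=
  (abs_le_sq_add_one j).trans (by nlinarith [sq_nonneg j])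

theorem six_mul_sq_add_two_mul_nonneg (j : ℤ) : 0 ≤ 6 * j ^ 2 + 2 * j := by
  rcases le_or_gt 0 j with h | h <;> nlinarith

theorem abs_le_six_mul_sq_add_two_mul (j : ℤ) : |j| ≤ 6 * j ^ 2 + 2 * j + 1 := by
  rw [abs_le]
  constructor <;> rcases le_or_gt 0 j with h | h <;> nlinarith

theorem six_mul_sq_add_six_mul_nonneg (j : ℤ) : 0 ≤ 6 * j ^ 2 + 6 * j + 1 := by
  rcases le_or_gt 0 j with h | h <;> nlinarith

theorem abs_le_six_mul_sq_add_six_mul (j : ℤ) : |j| ≤ 6 * j ^ 2 + 6 * j + 1 + 1 := by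
  rw [abs_le]
  constructor <;> rcases le_or_gt 0 j with h | h <;> nlinarith

/-- The product of Gauss's and Jacobi's series, with the weight `2 j + 1` changed to
`A = 2 j + 1 + i`; the additional weight `i` contributes nothing, because it is odd. -/
theorem hasSum_gauss_mul_jacobi :
    HasSum (fun p : ℤ × ℤ => qTerm ((-1) ^ (p.1 + p.2) * (2 * p.2 + 1 + p.1))
        (p.1 ^ 2 + (2 * p.2 ^ 2 + 2 * p.2)))
      (qPochInf X (X ^ 2) ^ 2 * qPochInf (X ^ 2) (X ^ 2) *
        (2 * qPochInf (X ^ 4) (X ^ 4) ^ 3)) := by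
  obtain ⟨s, hs⟩ := summable_qTerm_int (fun j => (-1) ^ j) (fun j => 2 * j ^ 2 + 2 * j)
    two_mul_sq_add_two_mul_nonneg abs_le_two_mul_sq_add_two_mul
  have h1 := HasSum.mul_qTerm_int (fun j => sq_nonneg j) abs_le_sq_add_one
    two_mul_sq_add_two_mul_nonneg abs_le_two_mul_sq_add_two_mul hasSum_gauss hasSum_jacobi
  have h0 : HasSum (fun j : ℤ => qTerm ((-1) ^ j * j) (j ^ 2)) 0 := by
    refine hasSum_zero_of_odd_qTerm (fun j => sq_nonneg j) abs_le_sq_add_one (fun j => ?_)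
      (fun j => by ring)
    rw [neg_one_zpow_eq_of_even_sub (n := j) ⟨-j, by ring⟩]
    push_cast
    ring
  have h2 := HasSum.mul_qTerm_int (fun j => sq_nonneg j) abs_le_sq_add_one
    two_mul_sq_add_two_mul_nonneg abs_le_two_mul_sq_add_two_mul h0 hs
  have h3 := h1.add h2
  rw [zero_mul, add_zero] at h3
  refine h3.congr_fun fun p => ?_
  rw [qTerm_add, zpow_add₀ (by norm_num)]
  congr 1
  ring

/-- The same double sum, split according to the residue of `A` modulo `3`. -/
theorem hasSum_split_residue {T : ℚ⟦X⟧}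
    (hT : HasSum (fun n : ℤ => qTerm (3 * n + 1) (3 * n ^ 2 + 2 * n)) T) :
    HasSum (fun p : ℤ × ℤ => qTerm ((-1) ^ (p.1 + p.2) * (2 * p.2 + 1 + p.1))
        (p.1 ^ 2 + (2 * p.2 ^ 2 + 2 * p.2)))
      (T * qPochInf (X ^ 4) (X ^ 4) + (T * qPochInf (X ^ 4) (X ^ 4) + 0)) := by
  have hclass := HasSum.mul_qTerm_int truncSum_exponent_nonneg abs_le_three_mul_sq_add_two_mul
    six_mul_sq_add_two_mul_nonneg abs_le_six_mul_sq_add_two_mul hT hasSum_pentagonal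
  have hzero : HasSum (fun p : ℤ × ℤ => qTerm (3 * p.1 * -(-1) ^ p.2)
      (3 * p.1 ^ 2 + (6 * p.2 ^ 2 + 6 * p.2 + 1))) 0 := by
    obtain ⟨s, hs⟩ := summable_qTerm_int (fun l => -(-1) ^ l) (fun l => 6 * l ^ 2 + 6 * l + 1)
      six_mul_sq_add_six_mul_nonneg abs_le_six_mul_sq_add_six_mul
    have h0 : HasSum (fun n : ℤ => qTerm (3 * n) (3 * n ^ 2)) 0 :=
      hasSum_zero_of_odd_qTerm three_mul_sq_nonneg abs_le_three_mul_sq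
        (fun j => by push_cast; ring) (fun j => by ring)
    have h1 := HasSum.mul_qTerm_int three_mul_sq_nonneg abs_le_three_mul_sq
      six_mul_sq_add_six_mul_nonneg abs_le_six_mul_sq_add_six_mul h0 hs
    rwa [zero_mul] at h1
  rw [← (Equiv.ofBijective _ bijective_residueParam).hasSum_iff]
  refine HasSum.sum (hclass.congr_fun ?_) (HasSum.sum (hclass.congr_fun ?_)
    (hzero.congr_fun ?_)) <;> rintro ⟨n, l⟩ <;>
    simp only [Function.comp_apply, Equiv.ofBijective_apply, residueParam]
  · rw [neg_one_zpow_eq_of_even_sub (n := l) ⟨n - l, by ring⟩]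
    push_cast
    congr 1 <;> ring
  · rw [neg_one_zpow_eq_of_even_sub (n := l + 1) ⟨-n - 1, by ring⟩,
      zpow_add₀ (by norm_num), zpow_one]
    push_cast
    congr 1 <;> ring
  · rw [neg_one_zpow_eq_of_even_sub (n := l + 1) ⟨n - l - 1, by ring⟩,
      zpow_add₀ (by norm_num), zpow_one]
    push_cast
    congr 1 <;> ring

/-- The weighted quintuple product identity
`∑ (3 n + 1) q ^ (3 n ^ 2 + 2 n) = (q; q²)²(q²; q²)(q⁴; q⁴)²`. -/
theorem hasSum_quintupleDenom :
    HasSum (fun n : ℤ => qTerm (3 * n + 1) (3 * n ^ 2 + 2 * n)) quintupleDenom := by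
  obtain ⟨T, hT⟩ := summable_qTerm_int (fun n => 3 * n + 1) (fun n => 3 * n ^ 2 + 2 * n)
    truncSum_exponent_nonneg abs_le_three_mul_sq_add_two_mul
  have h1 := hasSum_gauss_mul_jacobi.unique (hasSum_split_residue hT)
  have hE0 : qPochInf (X ^ 4) (X ^ 4) ≠ 0 := (isUnit_qPochInf (by norm_num) (by norm_num)).ne_zero
  have h2 : T = quintupleDenom := by
    refine mul_right_cancel₀ hE0 ?_
    rw [quintupleDenom]
    generalize qPochInf X (X ^ 2) ^ 2 * qPochInf (X ^ 2) (X ^ 2) = Φ at h1 ⊢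
    generalize qPochInf (X ^ 4) (X ^ 4) = E at h1 ⊢
    ext d
    have := congrArg (coeff d) h1
    rw [add_zero, mul_left_comm, two_mul, map_add, map_add, ← two_mul, ← two_mul] at this
    rw [mul_assoc, ← pow_succ]
    linarith
  exact h2 ▸ hT

theorem truncSum_eq_sum_qTerm (a b : ℤ) :
    truncSum a b = ∑ n ∈ Finset.Icc a b, qTerm (3 * n + 1) (3 * n ^ 2 + 2 * n) :=
  Finset.sum_congr rfl fun n _ => by rw [qTerm]; push_cast; rfl

theorem X_pow_dvd_quintupleDenom_sub_truncSum {N : ℕ} {a b : ℤ} (ha : a ≤ -N) (hb : N ≤ b) :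
    X ^ N ∣ quintupleDenom - truncSum a b := by
  rw [X_pow_dvd_iff]
  intro d hd
  have h := (WithPiTopology.hasSum_iff_hasSum_coeff _).mp hasSum_quintupleDenom d
  rw [map_sub, sub_eq_zero]
  refine h.unique ?_
  rw [truncSum_eq_sum_qTerm, map_sum]
  refine hasSum_sum_of_ne_finset_zero fun n hn => ?_
  rw [coeff_qTerm _ (truncSum_exponent_nonneg n)]
  refine if_neg fun h' => hn ?_
  have h1 := abs_le.mp (h' ▸ abs_le_three_mul_sq_add_two_mul n)
  exact Finset.mem_Icc.mpr ⟨by omega, by omega⟩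

/-! ### Twice iterated partial sums of the tails -/

/-- The coefficient of `q ^ (t - 1)` in `q ^ e / (1 - q) ^ 2`. -/
def ramp (t e : ℤ) : ℤ := max (t - e) 0

theorem ramp_of_le {t e : ℤ} (h : e ≤ t) : ramp t e = t - e := max_eq_left (by linarith)

theorem ramp_of_ge {t e : ℤ} (h : t ≤ e) : ramp t e = 0 := max_eq_right (by linarith)

/-- The coefficient of `q ^ (t - 1)` in the `k`-th pair of terms, those with index `k` and
`-(k + 1)`, divided by `(1 - q) ^ 2`. -/
def rampPos (t : ℤ) (k : ℕ) : ℤ :=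
  (3 * k + 1) * ramp t (3 * k ^ 2 + 2 * k) - (3 * k + 2) * ramp t (3 * k ^ 2 + 4 * k + 1)

/-- The coefficient of `q ^ (t - 1)` in the negative of the pair of terms with index `-(k + 1)` and
`k + 1`, divided by `(1 - q) ^ 2`. -/
def rampNeg (t : ℤ) (k : ℕ) : ℤ :=
  (3 * k + 2) * ramp t (3 * k ^ 2 + 4 * k + 1) - (3 * k + 4) * ramp t (3 * k ^ 2 + 8 * k + 5)

/-- The closed form of the twice iterated partial sums beyond the last exponent involved. -/
theorem sum_rampPos_eq {n M : ℕ} (h : n ≤ M) {t : ℤ} (ht : 3 * (M : ℤ) ^ 2 - 2 * M ≤ t) :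
    ∑ k ∈ Finset.Ico n M, rampPos t k =
      (M - n) * (3 * (M : ℤ) ^ 2 + 3 * M * n + 3 * n ^ 2 - 1 - t) := by
  induction M, h using Nat.le_induction with
  | base => simp
  | succ M h ih =>
    push_cast at ht ⊢
    rw [Finset.sum_Ico_succ_top h, ih (by nlinarith), rampPos, ramp_of_le (by nlinarith),
      ramp_of_le (by nlinarith)]
    ring

/-- The tail that starts with the term of index `n ≥ 1`, divided by `(1 - q) ^ 2`, has nonnegative
coefficients. The bound on `t` keeps the terms omitted from the sum out of play. -/
theorem sum_rampPos_nonneg {n M : ℕ} (hn : 1 ≤ n) (h : n ≤ M) {t : ℤ}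
    (ht : t ≤ 3 * (M : ℤ) ^ 2 + 2 * M) : 0 ≤ ∑ k ∈ Finset.Ico n M, rampPos t k := by
  induction M, h using Nat.le_induction with
  | base => simp
  | succ M h ih =>
    rw [Finset.sum_Ico_succ_top h]
    have hn' : (1 : ℤ) ≤ n := by exact_mod_cast hn
    have h' : (n : ℤ) ≤ M := by exact_mod_cast h
    rcases le_or_gt t (3 * (M : ℤ) ^ 2 + 2 * M) with h1 | h1
    · rw [rampPos, ramp_of_ge h1, ramp_of_ge (by linarith)]
      simpa using ih h1
    rw [sum_rampPos_eq h (by linarith), rampPos, ramp_of_le h1.le]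
    rcases le_or_gt t (3 * (M : ℤ) ^ 2 + 4 * M + 1) with h2 | h2
    · rw [ramp_of_ge h2]
      -- At `t = 3 M ^ 2 + 2 M` the first summand is nonnegative; the total slope is positive.
      have h3 : (0 : ℤ) ≤ (M - n) * (3 * M * n + 3 * n ^ 2 - 1 - 2 * M) :=
        mul_nonneg (by linarith) (by nlinarith)
      have h4 : (0 : ℤ) ≤ (2 * M + n + 1) * (t - (3 * (M : ℤ) ^ 2 + 2 * M)) :=
        mul_nonneg (by linarith) (by linarith)
      linarith
    · rw [ramp_of_le h2.le]
      have h3 : (0 : ℤ) ≤ ((M : ℤ) + 1 - n) *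
          (3 * (M + 1) ^ 2 + 3 * (M + 1) * n + 3 * n ^ 2 - 1 - t) := by
        push_cast at ht
        exact mul_nonneg (by linarith) (by nlinarith)
      linarith

/-- The closed form of the twice iterated partial sums beyond the last exponent involved. -/
theorem sum_rampNeg_eq {n M : ℕ} (h : n ≤ M) {t : ℤ} (ht : 3 * (M : ℤ) ^ 2 + 2 * M ≤ t) :
    ∑ k ∈ Finset.Ico n M, rampNeg t k =
      (M - n) * (6 * ((M : ℤ) ^ 2 + M * n + n ^ 2) + 9 * (M + n) + 3 - 2 * t) := by
  induction M, h using Nat.le_induction with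
  | base => simp
  | succ M h ih =>
    push_cast at ht ⊢
    rw [Finset.sum_Ico_succ_top h, ih (by nlinarith), rampNeg, ramp_of_le (by nlinarith),
      ramp_of_le (by nlinarith)]
    ring

/-- The tail that starts with the term of index `-(n + 1)`, divided by `(1 - q) ^ 2`, has nonpositive
coefficients. The bound on `t` keeps the terms omitted from the sum out of play. -/
theorem sum_rampNeg_nonneg {n M : ℕ} (h : n ≤ M) {t : ℤ}
    (ht : t ≤ 3 * (M : ℤ) ^ 2 + 4 * M + 1) : 0 ≤ ∑ k ∈ Finset.Ico n M, rampNeg t k := by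
  induction M, h using Nat.le_induction with
  | base => simp
  | succ M h ih =>
    rw [Finset.sum_Ico_succ_top h]
    have hn' : (0 : ℤ) ≤ n := n.cast_nonneg
    have h' : (n : ℤ) ≤ M := by exact_mod_cast h
    rcases le_or_gt t (3 * (M : ℤ) ^ 2 + 4 * M + 1) with h1 | h1
    · rw [rampNeg, ramp_of_ge h1, ramp_of_ge (by linarith)]
      simpa using ih h1
    rw [sum_rampNeg_eq h (by linarith), rampNeg, ramp_of_le h1.le]
    rcases le_or_gt t (3 * (M : ℤ) ^ 2 + 8 * M + 5) with h2 | h2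
    · rw [ramp_of_ge h2]
      -- At `t = 3 M ^ 2 + 4 M + 1` the first summand is nonnegative; the total slope is positive.
      have h3 : (0 : ℤ) ≤ (M - n) * (6 * M * n + 6 * n ^ 2 + M + 9 * n + 1) :=
        mul_nonneg (by linarith) (by positivity)
      have h4 : (0 : ℤ) ≤ (M + 2 * n + 2) * (t - (3 * (M : ℤ) ^ 2 + 4 * M + 1)) :=
        mul_nonneg (by linarith) (by linarith)
      linarith
    · rw [ramp_of_le h2.le]
      have h3 : (0 : ℤ) ≤ ((M : ℤ) + 1 - n) *
          (6 * ((M + 1) ^ 2 + (M + 1) * n + n ^ 2) + 9 * (M + 1 + n) + 3 - 2 * t) := by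
        push_cast at ht
        exact mul_nonneg (by linarith) (by nlinarith)
      linarith

/-! ### Nonnegativity of the reciprocal of the product -/

theorem coeff_mul_nonneg {f g : ℚ⟦X⟧} {D : ℕ} (hf : ∀ d, 0 ≤ coeff d f)
    (hg : ∀ d ≤ D, 0 ≤ coeff d g) : ∀ d ≤ D, 0 ≤ coeff d (f * g) := by
  intro d hd
  rw [coeff_mul]
  refine Finset.sum_nonneg fun p hp => mul_nonneg (hf _) (hg _ ?_)
  have := Finset.HasAntidiagonal.mem_antidiagonal.mp hp
  omega

theorem coeff_nonneg_of_one_sub_X_pow_mul {g : ℚ⟦X⟧} {e D : ℕ} (he : 1 ≤ e)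
    (h : ∀ d ≤ D, 0 ≤ coeff d ((1 - X ^ e) * g)) : ∀ d ≤ D, 0 ≤ coeff d g := by
  intro d
  induction d using Nat.strong_induction_on with
  | _ d ih =>
    intro hd
    have h1 := h d hd
    rw [sub_mul, one_mul, map_sub, coeff_X_pow_mul'] at h1
    split_ifs at h1 with h2
    · have := ih (d - e) (by omega) (by omega)
      linarith
    · linarith

theorem coeff_nonneg_of_prod_mul {g : ℚ⟦X⟧} {k m D : ℕ} (hk : 1 ≤ k) (N : ℕ)
    (h : ∀ d ≤ D, 0 ≤ coeff d ((∏ i ∈ Finset.range N, (1 - X ^ k * (X ^ m) ^ i)) * g)) :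
    ∀ d ≤ D, 0 ≤ coeff d g := by
  induction N with
  | zero => simpa using h
  | succ N ih =>
    refine ih (coeff_nonneg_of_one_sub_X_pow_mul (e := k + m * N) (by omega) ?_)
    rw [Finset.prod_range_succ, ← pow_mul, ← pow_add, mul_comm _ (1 - _), mul_assoc] at h
    exact h

/-- The reciprocal of an infinite `q`-Pochhammer symbol has nonnegative coefficients. -/
theorem exists_qPochInf_mul_eq_one {k m : ℕ} (hk : 1 ≤ k) (hm : 1 ≤ m) :
    ∃ V : ℚ⟦X⟧, qPochInf (X ^ k) (X ^ m) * V = 1 ∧ ∀ d, 0 ≤ coeff d V := by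
  obtain ⟨V, hV⟩ := (isUnit_qPochInf hk hm).exists_right_inv
  refine ⟨V, hV, fun D => coeff_nonneg_of_prod_mul (m := m) hk D (fun d hd => ?_) D le_rfl⟩
  have h1 := (X_pow_dvd_qPochInf_sub (k := k) hm D).mul_right V
  rw [sub_mul, hV] at h1
  have h2 := X_pow_dvd_iff.mp h1 d (by nlinarith)
  rw [map_sub, sub_eq_zero] at h2
  rw [← h2, coeff_one]
  split_ifs <;> norm_num

theorem qPochInf_X_sq : qPochInf X (X ^ 2) = (1 - X) * qPochInf (X ^ 3) (X ^ 2) := by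
  have h : ∀ i, (1 : ℚ⟦X⟧) - X * (X ^ 2) ^ (i + 1) = 1 - X ^ 3 * (X ^ 2) ^ i := fun i => by ring
  have hm := multipliable_qPochInf 3 2 (by norm_num)
  rw [qPochInf, tprod_eq_zero_mul' (by simpa only [h] using hm)]
  simp only [h, pow_zero, mul_one]
  rfl

/-- The power series `1 / (1 - q) ^ 2 = ∑ (d + 1) q ^ d`. -/
noncomputable def invOneSubSq : ℚ⟦X⟧ := mk fun d => (d + 1 : ℚ)

theorem one_sub_X_sq_mul_invOneSubSq : (1 - X) ^ 2 * invOneSubSq = 1 := by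
  have h : (1 - X) * invOneSubSq = mk 1 := by
    ext d
    rw [sub_mul, one_mul, map_sub, invOneSubSq, coeff_mk, coeff_mk]
    cases d with
    | zero => simp
    | succ d => rw [coeff_succ_X_mul, coeff_mk]; push_cast; simp
  rw [sq, mul_assoc, h, mul_comm]
  exact mk_one_mul_one_sub_eq_one ℚ

theorem coeff_invOneSubSq_mul_qTerm (c : ℚ) {e : ℤ} (he : 0 ≤ e) (d : ℕ) :
    coeff d (invOneSubSq * qTerm c e) = c * ramp (d + 1) e := by
  rw [qTerm, mul_left_comm, coeff_C_mul, coeff_mul_X_pow', invOneSubSq]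
  split_ifs with h
  · rw [coeff_mk, ramp_of_le (by omega), Nat.cast_sub h]
    have : ((e.toNat : ℕ) : ℚ) = e := by exact_mod_cast Int.toNat_of_nonneg he
    rw [this]
    push_cast
    ring
  · rw [ramp_of_ge (by omega)]; simp

/-- The reciprocal of the product is `1 / (1 - q) ^ 2` times a series with nonnegative
coefficients. -/
theorem exists_quintupleDenom_inv_eq : ∃ W : ℚ⟦X⟧,
    quintupleDenom⁻¹ = W * invOneSubSq ∧ ∀ d, 0 ≤ coeff d W := by
  obtain ⟨V₁, h₁, p₁⟩ := exists_qPochInf_mul_eq_one (k := 3) (m := 2) (by norm_num) (by norm_num)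
  obtain ⟨V₂, h₂, p₂⟩ := exists_qPochInf_mul_eq_one (k := 2) (m := 2) (by norm_num) (by norm_num)
  obtain ⟨V₄, h₄, p₄⟩ := exists_qPochInf_mul_eq_one (k := 4) (m := 4) (by norm_num) (by norm_num)
  have hmul : ∀ {f g : ℚ⟦X⟧}, (∀ d, 0 ≤ coeff d f) → (∀ d, 0 ≤ coeff d g) →
      ∀ d, 0 ≤ coeff d (f * g) := fun hf hg d =>
    coeff_mul_nonneg hf (fun d _ => hg d) d le_rfl
  refine ⟨V₁ * V₁ * (V₂ * (V₄ * V₄)), ?_, hmul (hmul p₁ p₁) (hmul p₂ (hmul p₄ p₄))⟩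
  have h : quintupleDenom * (V₁ * V₁ * (V₂ * (V₄ * V₄)) * invOneSubSq) = 1 := by
    rw [quintupleDenom, qPochInf_X_sq]
    calc _ = ((1 - X) ^ 2 * invOneSubSq) * (qPochInf (X ^ 3) (X ^ 2) * V₁) ^ 2 *
          (qPochInf (X ^ 2) (X ^ 2) * V₂) * (qPochInf (X ^ 4) (X ^ 4) * V₄) ^ 2 := by ring
      _ = 1 := by rw [one_sub_X_sq_mul_invOneSubSq, h₁, h₂, h₄]; norm_num
  calc quintupleDenom⁻¹ = quintupleDenom⁻¹ *
        (quintupleDenom * (V₁ * V₁ * (V₂ * (V₄ * V₄)) * invOneSubSq)) := by rw [h, mul_one]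
    _ = (quintupleDenom * quintupleDenom⁻¹) * (V₁ * V₁ * (V₂ * (V₄ * V₄)) * invOneSubSq) := by ring
    _ = _ := by rw [quintupleDenom_mul_inv, one_mul]

theorem coeff_quintupleDenom_inv_mul_nonneg {Y : ℚ⟦X⟧} {D : ℕ}
    (h : ∀ d ≤ D, 0 ≤ coeff d (invOneSubSq * Y)) : 0 ≤ coeff D (quintupleDenom⁻¹ * Y) := by
  obtain ⟨W, hW, hp⟩ := exists_quintupleDenom_inv_eq
  rw [hW, mul_assoc]
  exact coeff_mul_nonneg hp h D le_rfl

/-! ### Truncated sums -/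

theorem truncSum_split {a b c : ℤ} (h : a ≤ b + 1) (h' : b ≤ c) :
    truncSum a c = truncSum a b + truncSum (b + 1) c := by
  rw [truncSum, truncSum, truncSum, ← Finset.sum_union]
  · refine Finset.sum_congr ?_ fun _ _ => rfl
    ext n
    simp only [Finset.mem_union, Finset.mem_Icc]
    omega
  · rw [Finset.disjoint_left]
    intro n h1 h2
    have := Finset.mem_Icc.mp h1
    have := Finset.mem_Icc.mp h2
    omega

theorem truncSum_self (a : ℤ) : truncSum a a = qTerm (3 * a + 1) (3 * a ^ 2 + 2 * a) := by
  rw [truncSum_eq_sum_qTerm, Finset.Icc_self, Finset.sum_singleton]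

theorem truncSum_symm_succ (a b : ℤ) (h : a ≤ b + 1) : truncSum (a - 1) (b + 1) =
    truncSum a b + (truncSum (a - 1) (a - 1) + truncSum (b + 1) (b + 1)) := by
  rw [truncSum_split (a := a - 1) (b := a - 1) (c := b + 1) (by omega) (by omega),
    sub_add_cancel, truncSum_split (a := a) (b := b) (c := b + 1) (by omega) (by omega)]
  ring

theorem coeff_quintupleDenom_inv_mul_qTerm_nonneg {c : ℚ} (hc : 0 ≤ c) {e : ℤ} (he : 0 ≤ e)
    (d : ℕ) : 0 ≤ coeff d (quintupleDenom⁻¹ * qTerm c e) := by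
  refine coeff_quintupleDenom_inv_mul_nonneg fun d' _ => ?_
  rw [coeff_invOneSubSq_mul_qTerm c he]
  exact mul_nonneg hc (by exact_mod_cast le_max_right _ _)

theorem coeff_inv_mul_truncSum_nonneg {a : ℤ} (ha : 0 ≤ a) (b : ℤ) (d : ℕ) :
    0 ≤ coeff d (quintupleDenom⁻¹ * truncSum a b) := by
  rw [truncSum_eq_sum_qTerm, Finset.mul_sum, map_sum]
  refine Finset.sum_nonneg fun n hn => ?_
  have : 0 ≤ n := ha.trans (Finset.mem_Icc.mp hn).1
  exact coeff_quintupleDenom_inv_mul_qTerm_nonneg (by positivity) (truncSum_exponent_nonneg n) d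

theorem coeff_inv_mul_truncSum_nonpos (a : ℤ) {b : ℤ} (hb : b < 0) (d : ℕ) :
    coeff d (quintupleDenom⁻¹ * truncSum a b) ≤ 0 := by
  rw [truncSum_eq_sum_qTerm, Finset.mul_sum, map_sum]
  refine Finset.sum_nonpos fun n hn => ?_
  have : n + 1 ≤ 0 := (Finset.mem_Icc.mp hn).2.trans_lt hb
  have h : (n : ℚ) + 1 ≤ 0 := by exact_mod_cast this
  have := coeff_quintupleDenom_inv_mul_qTerm_nonneg (c := -(3 * n + 1)) (by linarith)
    (truncSum_exponent_nonneg n) d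
  rw [← neg_qTerm, mul_neg, map_neg] at this
  linarith

/-- A sufficiently long truncated sum agrees with the whole product in low degrees, so that its
quotient by the product agrees with `1`. -/
theorem coeff_inv_mul_truncSum_eq_zero {a b : ℤ} {d : ℕ} (hd : 1 ≤ d) (ha : a ≤ -(d + 1 : ℕ))
    (hb : (d + 1 : ℕ) ≤ b) : coeff d (quintupleDenom⁻¹ * truncSum a b) = 0 := by
  have h1 := (X_pow_dvd_quintupleDenom_sub_truncSum ha hb).mul_left quintupleDenom⁻¹
  rw [mul_sub, mul_comm _ quintupleDenom, quintupleDenom_mul_inv] at h1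
  have h2 := X_pow_dvd_iff.mp h1 d (by omega)
  rw [map_sub, coeff_one, if_neg (by omega)] at h2
  linarith

/-- The truncation that ends just before the term of index `n ≥ 1`. -/
theorem coeff_inv_mul_truncSum_neg_pred_nonpos {n d : ℕ} (hn : 1 ≤ n) (hd : 1 ≤ d) :
    coeff d (quintupleDenom⁻¹ * truncSum (-n) (n - 1)) ≤ 0 := by
  have hY : ∀ M, n ≤ M → truncSum (-M) (M - 1) = truncSum (-n) (n - 1) +
      ∑ k ∈ Finset.Ico n M, (qTerm (3 * k + 1) (3 * k ^ 2 + 2 * k) -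
        qTerm (3 * k + 2) (3 * k ^ 2 + 4 * k + 1)) := by
    intro M h
    induction M, h using Nat.le_induction with
    | base => simp
    | succ M h ih =>
      have e := truncSum_symm_succ (-M) (M - 1) (by omega)
      rw [show -(M : ℤ) - 1 = -((M + 1 : ℕ) : ℤ) by push_cast; ring,
        show (M : ℤ) - 1 + 1 = ((M + 1 : ℕ) : ℤ) - 1 by push_cast; ring] at e
      have e1 : truncSum (-((M + 1 : ℕ) : ℤ)) (-((M + 1 : ℕ) : ℤ)) =
          -qTerm (3 * M + 2) (3 * M ^ 2 + 4 * M + 1) := by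
        rw [truncSum_self, neg_qTerm]
        congr 1 <;> push_cast <;> ring
      have e2 : truncSum (((M + 1 : ℕ) : ℤ) - 1) (((M + 1 : ℕ) : ℤ) - 1) =
          qTerm (3 * M + 1) (3 * M ^ 2 + 2 * M) := by
        rw [truncSum_self]
        congr 1 <;> push_cast <;> ring
      rw [e, ih, Finset.sum_Ico_succ_top h, e1, e2]
      ring
  have hM := hY (n + d + 2) (by omega)
  have h0 := coeff_inv_mul_truncSum_eq_zero (a := -((n + d + 2 : ℕ) : ℤ))
    (b := ((n + d + 2 : ℕ) : ℤ) - 1) hd (by omega) (by omega)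
  rw [hM, mul_add, map_add] at h0
  suffices 0 ≤ coeff d (quintupleDenom⁻¹ * ∑ k ∈ Finset.Ico n (n + d + 2),
      (qTerm (3 * k + 1) (3 * k ^ 2 + 2 * k) - qTerm (3 * k + 2) (3 * k ^ 2 + 4 * k + 1))) by
    linarith
  refine coeff_quintupleDenom_inv_mul_nonneg fun d' hd' => ?_
  have h1 := sum_rampPos_nonneg (t := d' + 1) hn (show n ≤ n + d + 2 by omega)
    (by push_cast; nlinarith)
  have h2 : coeff d' (invOneSubSq * ∑ k ∈ Finset.Ico n (n + d + 2),
      (qTerm (3 * k + 1) (3 * k ^ 2 + 2 * k) - qTerm (3 * k + 2) (3 * k ^ 2 + 4 * k + 1))) =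
      ((∑ k ∈ Finset.Ico n (n + d + 2), rampPos (d' + 1) k : ℤ) : ℚ) := by
    rw [Finset.mul_sum, map_sum, Int.cast_sum]
    refine Finset.sum_congr rfl fun k _ => ?_
    rw [mul_sub, map_sub, coeff_invOneSubSq_mul_qTerm _ (by positivity),
      coeff_invOneSubSq_mul_qTerm _ (by positivity), rampPos]
    push_cast
    rfl
  rw [h2]
  exact_mod_cast h1

/-- The truncation that ends just before the term of index `-(n + 1)`. -/
theorem coeff_inv_mul_truncSum_neg_self_nonneg (n : ℕ) {d : ℕ} (hd : 1 ≤ d) :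
    0 ≤ coeff d (quintupleDenom⁻¹ * truncSum (-n) n) := by
  have hY : ∀ M, n ≤ M → truncSum (-M) M = truncSum (-n) n -
      ∑ k ∈ Finset.Ico n M, (qTerm (3 * k + 2) (3 * k ^ 2 + 4 * k + 1) -
        qTerm (3 * k + 4) (3 * k ^ 2 + 8 * k + 5)) := by
    intro M h
    induction M, h using Nat.le_induction with
    | base => simp
    | succ M h ih =>
      have e := truncSum_symm_succ (-M) M (by omega)
      rw [show -(M : ℤ) - 1 = -((M + 1 : ℕ) : ℤ) by push_cast; ring,
        show (M : ℤ) + 1 = ((M + 1 : ℕ) : ℤ) by push_cast; ring] at e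
      have e1 : truncSum (-((M + 1 : ℕ) : ℤ)) (-((M + 1 : ℕ) : ℤ)) =
          -qTerm (3 * M + 2) (3 * M ^ 2 + 4 * M + 1) := by
        rw [truncSum_self, neg_qTerm]
        congr 1 <;> push_cast <;> ring
      have e2 : truncSum ((M + 1 : ℕ) : ℤ) ((M + 1 : ℕ) : ℤ) =
          qTerm (3 * M + 4) (3 * M ^ 2 + 8 * M + 5) := by
        rw [truncSum_self]
        congr 1 <;> push_cast <;> ring
      rw [e, ih, Finset.sum_Ico_succ_top h, e1, e2]
      ring
  have hM := hY (n + d + 2) (by omega)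
  have h0 := coeff_inv_mul_truncSum_eq_zero (a := -((n + d + 2 : ℕ) : ℤ))
    (b := ((n + d + 2 : ℕ) : ℤ)) hd (by omega) (by omega)
  rw [hM, mul_sub, map_sub, sub_eq_zero] at h0
  rw [h0]
  refine coeff_quintupleDenom_inv_mul_nonneg fun d' hd' => ?_
  have h1 := sum_rampNeg_nonneg (t := d' + 1) (show n ≤ n + d + 2 by omega)
    (by push_cast; nlinarith)
  have h2 : coeff d' (invOneSubSq * ∑ k ∈ Finset.Ico n (n + d + 2),
      (qTerm (3 * k + 2) (3 * k ^ 2 + 4 * k + 1) - qTerm (3 * k + 4) (3 * k ^ 2 + 8 * k + 5))) =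
      ((∑ k ∈ Finset.Ico n (n + d + 2), rampNeg (d' + 1) k : ℤ) : ℚ) := by
    rw [Finset.mul_sum, map_sum, Int.cast_sum]
    refine Finset.sum_congr rfl fun k _ => ?_
    rw [mul_sub, map_sub, coeff_invOneSubSq_mul_qTerm _ (by positivity),
      coeff_invOneSubSq_mul_qTerm _ (by positivity), rampNeg]
    push_cast
    rfl
  rw [h2]
  exact_mod_cast h1

theorem theorem1p6 (a b : ℤ) (k : ℕ) (hk : 1 ≤ k) :
    0 ≤ coeff k (C ((Sg (a + b) : ℤ) : ℚ) * quintupleDenom⁻¹ * truncSum a b) := by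
  rw [mul_assoc, coeff_C_mul]
  rcases lt_or_ge b a with hab | hab
  · rw [truncSum, Finset.Icc_eq_empty (not_le.mpr hab)]
    simp
  rcases le_or_gt 0 (a + b) with hs | hs
  · rw [Sg, if_pos hs, Int.cast_one, one_mul]
    rcases le_or_gt 0 a with ha | ha
    · exact coeff_inv_mul_truncSum_nonneg ha b k
    obtain ⟨n, hn⟩ := Int.eq_ofNat_of_zero_le (neg_nonneg.mpr ha.le)
    rw [truncSum_split (a := a) (b := n) (c := b) (by omega) (by omega), mul_add, map_add,
      show a = -n by omega]
    exact add_nonneg (coeff_inv_mul_truncSum_neg_self_nonneg n hk)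
      (coeff_inv_mul_truncSum_nonneg (by omega) b k)
  · rw [Sg, if_neg (not_le.mpr hs)]
    suffices coeff k (quintupleDenom⁻¹ * truncSum a b) ≤ 0 by push_cast; linarith
    rcases lt_or_ge b 0 with hb | hb
    · exact coeff_inv_mul_truncSum_nonpos a hb k
    obtain ⟨n, rfl⟩ := Int.eq_ofNat_of_zero_le hb
    rw [truncSum_split (a := a) (b := -((n + 1 : ℕ) : ℤ) - 1) (c := n) (by omega) (by omega),
      mul_add, map_add, sub_add_cancel, show (n : ℤ) = ((n + 1 : ℕ) : ℤ) - 1 by omega]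
    exact add_nonpos (coeff_inv_mul_truncSum_nonpos a (by omega) k)
      (coeff_inv_mul_truncSum_neg_pred_nonpos (by omega) hk)
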